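/- Let $R$ be a lattice-ordered division ring, that is, a (not necessarily commutative) division ring with a lattice order such that $a\le b$ implies $a+c\le b+c$, and $a,b\ge 0$ implies $ab\ge 0$ (it is not assumed that $1\ge 0$). Then the following statements are equivalent: 1. $a^2\ge 0$ for all $a\in R$. 2. $R$ is order division-closed: for all $a,b\in R$, if $ab>0$ and one of $a,b$ is $>0$, then so is the other. 3. $R$ is totally ordered. 4. For every $a\in R$ there is an integer $n_a\ge 1$ such that $a^{n_a}\ge 0$. 5. $R$ is an f-ring: for all $a,b,c\in R$, $a\wedge b=0$ and $c\ge 0$ imply $ca\wedge b=ac\wedge b=0$. 6. $R$ is an almost f-ring: for all $a,b\in R$, $a\wedge b=0$ implies $ab=0$. 7. The ordered additive group of $R$ is isomorphic, as a partially ordered group, to the group of divisibility of some valuation domain $D$, that is, to the group $K^\times/D^\times$, where $K$ is the field of fractions of $D$, ordered by $xD^\times\le yD^\times$ if and only if $yx^{-1}\in D$. 8. Each strictly positive element of $R$ has a strictly positive multiplicative inverse. -/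

import Mathlib

universe u

/-- A lattice-ordered ring `R` is order division-closed if, whenever `a * b > 0` and one of `a`, `b`
is strictly positive, then so is the other one. -/
def IsOrderDivisionClosed (R : Type*) [Ring R] [Lattice R] : Prop :=
  ∀ a b : R, 0 < a * b → (0 < a → 0 < b) ∧ (0 < b → 0 < a)

/-- The defining condition of an f-ring among lattice-ordered rings. -/
def IsFRing (R : Type*) [Ring R] [Lattice R] : Prop :=
  ∀ a b c : R, a ⊓ b = 0 → 0 ≤ c → (c * a) ⊓ b = 0 ∧ (a * c) ⊓ b = 0

/-- The defining condition of an almost f-ring among lattice-ordered rings. -/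
def IsAlmostFRing (R : Type*) [Ring R] [Lattice R] : Prop :=
  ∀ a b : R, a ⊓ b = 0 → a * b = 0

/-- The group of divisibility of an integral domain `D` with field of fractions `K`: the quotient
`Kˣ / Dˣ` (written multiplicatively). -/
def GroupOfDivisibility (D K : Type*) [CommRing D] [Field K] [Algebra D K] : Type _ :=
  Kˣ ⧸ (Units.map (algebraMap D K : D →* K)).range

namespace GroupOfDivisibility

variable (D K : Type*) [CommRing D] [Field K] [Algebra D K]

instance instCommGroup : CommGroup (GroupOfDivisibility D K) :=
  inferInstanceAs (CommGroup (Kˣ ⧸ (Units.map (algebraMap D K : D →* K)).range))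

/-- The class `q Dˣ` of a nonzero element `q` of `K`. -/
def mk : Kˣ →* GroupOfDivisibility D K :=
  QuotientGroup.mk' (Units.map (algebraMap D K : D →* K)).range

/-- The divisibility order: `x Dˣ ≤ y Dˣ` if and only if `y = d x` for some `d` in `D`; the positive
cone consists of the classes of the nonzero elements of `D`. -/
instance instPartialOrder [IsDomain D] [IsFractionRing D K] :
    PartialOrder (GroupOfDivisibility D K) where
  le x y := ∃ q : Kˣ, (∃ d : D, algebraMap D K d = (q : K)) ∧ y = mk D K q * x
  le_refl x := ⟨1, ⟨1, by simp⟩, by simp⟩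
  le_trans := by
    rintro x y z ⟨p, ⟨c, hc⟩, rfl⟩ ⟨q, ⟨d, hd⟩, rfl⟩
    exact ⟨q * p, ⟨d * c, by simp [hc, hd]⟩, by rw [map_mul, mul_assoc]⟩
  le_antisymm := by
    rintro x y ⟨p, ⟨c, hc⟩, rfl⟩ ⟨q, ⟨d, hd⟩, h⟩
    have h1 : mk D K (q * p) = 1 := by
      rw [← mul_assoc, ← map_mul] at h
      exact mul_eq_right.mp h.symm
    obtain ⟨u, hu⟩ := (QuotientGroup.eq_one_iff (q * p)).mp h1
    have h2 : (u : D) = d * c := by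
      apply IsFractionRing.injective D K
      have := congrArg Units.val hu
      simpa [hc, hd] using this
    have h3 : IsUnit c := isUnit_of_mul_isUnit_right (h2 ▸ u.isUnit)
    have h4 : mk D K p = 1 :=
      (QuotientGroup.eq_one_iff p).mpr ⟨h3.unit, Units.ext (by simpa using hc)⟩
    rw [h4, one_mul]

end GroupOfDivisibility

section LatticeOrderedDivisionRing

variable {R : Type*} [DivisionRing R] [Lattice R]

/-! Everything is tied to totality of the order. Totality means that disjoint elements cannot both
be nonzero; an almost f-ring has this property because a division ring has no zero divisors. The
power, square and division conditions each make inverses of positive elements positive, and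
`total_of_inv_pos` then excludes nonzero disjoint pairs. The group of divisibility of a valuation
domain is totally ordered; conversely, an ordered group `G` is the value group of a field of Hahn
series with exponents in `G`. -/

theorem mul_pos_of_mul_nonneg (hmul : ∀ a b : R, 0 ≤ a → 0 ≤ b → 0 ≤ a * b) {a b : R}
    (ha : 0 < a) (hb : 0 < b) : 0 < a * b :=
  (hmul a b ha.le hb.le).lt_of_ne' (mul_ne_zero ha.ne' hb.ne')

/-- Subtracting `a ⊓ b` from both elements makes them disjoint. -/
theorem total_of_disjoint_imp_eq_zero [IsOrderedAddMonoid R]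
    (h : ∀ a b : R, a ⊓ b = 0 → a = 0 ∨ b = 0) (a b : R) : a ≤ b ∨ b ≤ a := by
  have key : (a - a ⊓ b) ⊓ (b - a ⊓ b) = 0 := by
    rw [← inf_sub, sub_self]
  rcases h _ _ key with h | h
  · exact Or.inl (inf_eq_left.mp (sub_eq_zero.mp h).symm)
  · exact Or.inr (inf_eq_right.mp (sub_eq_zero.mp h).symm)

/-- If strictly positive elements have strictly positive inverses, then two disjoint elements
`a, b > 0` would give `c = a⁻¹ * b` disjoint from `1`, while `0 < (1 + c)⁻¹ * c ≤ 1 ⊓ c`. -/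
theorem total_of_inv_pos [IsOrderedAddMonoid R]
    (hmul : ∀ a b : R, 0 ≤ a → 0 ≤ b → 0 ≤ a * b)
    (hinv : ∀ a : R, 0 < a → 0 < a⁻¹) (a b : R) : a ≤ b ∨ b ≤ a := by
  refine total_of_disjoint_imp_eq_zero (fun a b hab => ?_) a b
  by_contra! hne
  have ha : 0 < a := (hab ▸ inf_le_left : (0 : R) ≤ a).lt_of_ne' hne.1
  have hb : 0 < b := (hab ▸ inf_le_right : (0 : R) ≤ b).lt_of_ne' hne.2
  have mono : ∀ {c x y : R}, 0 ≤ c → x ≤ y → c * x ≤ c * y := fun {c x y} hc hxy => by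
    have := hmul c (y - x) hc (sub_nonneg.mpr hxy)
    rwa [mul_sub, sub_nonneg] at this
  have one_pos' : (0 : R) < 1 := by
    simpa [ha.ne'] using mul_pos_of_mul_nonneg hmul ha (hinv a ha)
  have hc : 0 < a⁻¹ * b := mul_pos_of_mul_nonneg hmul (hinv a ha) hb
  set c := a⁻¹ * b with hc_def
  have hs : 0 < 1 + c := add_pos one_pos' hc
  have hd : 0 < (1 + c)⁻¹ := hinv _ hs
  set d := (1 + c)⁻¹ with hd_def
  have hdc : 0 < d * c := mul_pos_of_mul_nonneg hmul hd hc
  have hsum : d + d * c = 1 := by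
    have := inv_mul_cancel₀ hs.ne'
    rwa [mul_add, mul_one] at this
  have hd_le : d ≤ 1 := hsum ▸ le_add_of_nonneg_right hdc.le
  have hdc_le : d * c ≤ 1 := hsum ▸ le_add_of_nonneg_left hd.le
  have hdc_le' : d * c ≤ c := by
    have := hmul (1 - d) c (sub_nonneg.mpr hd_le) hc.le
    rwa [sub_mul, one_mul, sub_nonneg] at this
  -- Since `a * c = b`, scaling `d * c ≤ 1 ⊓ c` by `a` puts a positive element below `a ⊓ b = 0`.
  have h1 : a * (d * c) ≤ a := by simpa using mono ha.le hdc_le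
  have h2 : a * (d * c) ≤ b := by
    simpa [hc_def, mul_inv_cancel_left₀ ha.ne'] using mono ha.le hdc_le'
  exact ((mul_pos_of_mul_nonneg hmul ha hdc).trans_le (le_inf h1 h2)).ne' hab

/-- Two applications of the f-ring condition turn `a ⊓ b = 0` into `(a * b) ⊓ (a * b) = 0`. -/
theorem IsFRing.isAlmostFRing (h : IsFRing R) : IsAlmostFRing R := fun a b hab => by
  have ha : 0 ≤ a := hab ▸ inf_le_left
  have hb : 0 ≤ b := hab ▸ inf_le_right
  have h1 : b ⊓ (a * b) = 0 := by rw [inf_comm]; exact (h a b b hab hb).2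
  simpa using (h b (a * b) a h1 ha).1

/-- Multiplying a nonnegative power of `a⁻¹` by `a` repeatedly lowers the exponent to 1. -/
theorem inv_pos_of_exists_pow_nonneg (hmul : ∀ a b : R, 0 ≤ a → 0 ≤ b → 0 ≤ a * b)
    (h : ∀ a : R, ∃ n : ℕ, 1 ≤ n ∧ 0 ≤ a ^ n) (a : R) (ha : 0 < a) : 0 < a⁻¹ := by
  refine lt_of_le_of_ne' ?_ (inv_ne_zero ha.ne')
  obtain ⟨n, hn, hpow⟩ := h a⁻¹
  have key : ∀ k : ℕ, 0 ≤ a⁻¹ ^ (k + 1) → 0 ≤ a⁻¹ := by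
    intro k
    induction k with
    | zero => simp
    | succ k ih =>
      intro hk
      refine ih ?_
      have := hmul _ _ ha.le hk
      rwa [pow_succ' _ (k + 1), mul_inv_cancel_left₀ ha.ne'] at this
  obtain ⟨k, rfl⟩ := Nat.exists_eq_add_of_le' hn
  exact key k hpow

theorem IsOrderDivisionClosed.inv_pos (h : IsOrderDivisionClosed R) (a : R) (ha : 0 < a) :
    0 < a⁻¹ := by
  have h1 : (0 : R) < 1 := (h a 1 (by rwa [mul_one])).1 ha
  exact (h a a⁻¹ (by rwa [mul_inv_cancel₀ ha.ne'])).1 ha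

theorem isOrderDivisionClosed_of_total [IsOrderedAddMonoid R]
    (hmul : ∀ a b : R, 0 ≤ a → 0 ≤ b → 0 ≤ a * b)
    (h : ∀ a b : R, a ≤ b ∨ b ≤ a) : IsOrderDivisionClosed R := by
  refine fun a b hab => ⟨fun ha => ?_, fun hb => ?_⟩
  · refine lt_of_le_of_ne' ((h 0 b).resolve_right fun hb => ?_) (right_ne_zero_of_mul hab.ne')
    have := hmul a (-b) ha.le (neg_nonneg.mpr hb)
    rw [mul_neg, neg_nonneg] at this
    exact hab.not_ge this
  · refine lt_of_le_of_ne' ((h 0 a).resolve_right fun ha => ?_) (left_ne_zero_of_mul hab.ne')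
    have := hmul (-a) b (neg_nonneg.mpr ha) hb.le
    rw [neg_mul, neg_nonneg] at this
    exact hab.not_ge this

theorem sq_nonneg_of_total [IsOrderedAddMonoid R]
    (hmul : ∀ a b : R, 0 ≤ a → 0 ≤ b → 0 ≤ a * b)
    (h : ∀ a b : R, a ≤ b ∨ b ≤ a) (a : R) : 0 ≤ a ^ 2 := by
  rcases h 0 a with ha | ha
  · simpa [sq] using hmul a a ha ha
  · simpa [sq] using hmul (-a) (-a) (neg_nonneg.mpr ha) (neg_nonneg.mpr ha)

theorem isFRing_of_total (hmul : ∀ a b : R, 0 ≤ a → 0 ≤ b → 0 ≤ a * b)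
    (h : ∀ a b : R, a ≤ b ∨ b ≤ a) : IsFRing R := by
  intro a b c hab hc
  have ha : 0 ≤ a := hab ▸ inf_le_left
  have hb : 0 ≤ b := hab ▸ inf_le_right
  rcases h a b with hle | hle
  · obtain rfl : a = 0 := by rwa [inf_eq_left.mpr hle] at hab
    simpa using hb
  · obtain rfl : b = 0 := by rwa [inf_eq_right.mpr hle] at hab
    exact ⟨inf_eq_right.mpr (hmul c a hc ha), inf_eq_right.mpr (hmul a c ha hc)⟩

end LatticeOrderedDivisionRing

namespace GroupOfDivisibility

theorem mk_surjective {D K : Type*} [CommRing D] [Field K] [Algebra D K] :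
    Function.Surjective (mk D K) := QuotientGroup.mk'_surjective _

variable {D K : Type*} [CommRing D] [IsDomain D] [Field K] [Algebra D K] [IsFractionRing D K]

/-- Equality of classes leaves a unit of `D` undetermined; it is absorbed into `d`. -/
theorem mk_le_mk {x y : Kˣ} :
    mk D K x ≤ mk D K y ↔ ∃ d : D, algebraMap D K d = (y : K) * (x : K)⁻¹ := by
  constructor
  · rintro ⟨q, ⟨d, hd⟩, h⟩
    rw [← map_mul] at h
    obtain ⟨u, hu⟩ := QuotientGroup.eq.mp h
    refine ⟨d * ((u⁻¹ : Dˣ) : D), ?_⟩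
    have hu' : algebraMap D K ((u⁻¹ : Dˣ) : D) = ((y⁻¹ * (q * x))⁻¹ : Kˣ) := by
      rw [← hu, ← map_inv]; rfl
    rw [map_mul, hd, hu']
    simp only [mul_inv_rev, inv_inv, Units.val_mul, Units.val_inv_eq_inv_val]
    field_simp
  · rintro ⟨d, hd⟩
    exact ⟨y * x⁻¹, ⟨d, by simpa using hd⟩, by rw [← map_mul, inv_mul_cancel_right]⟩

theorem le_total_of_valuationRing [ValuationRing D] (x y : GroupOfDivisibility D K) :
    x ≤ y ∨ y ≤ x := by
  obtain ⟨x, rfl⟩ := mk_surjective x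
  obtain ⟨y, rfl⟩ := mk_surjective y
  rw [mk_le_mk, mk_le_mk]
  have h := ValuationRing.isInteger_or_isInteger D ((y : K) * (x : K)⁻¹)
  rwa [mul_inv_rev, inv_inv] at h

end GroupOfDivisibility

section HahnSeries

variable (G F : Type*) [AddCommGroup G] [LinearOrder G] [IsOrderedAddMonoid G] [Field F]

variable {G F} in
theorem HahnSeries.order_inv_eq_neg {x : HahnSeries G F} (hx : x ≠ 0) : x⁻¹.order = -x.order := by
  have h := HahnSeries.order_mul hx (inv_ne_zero hx)
  rw [mul_inv_cancel₀ hx, HahnSeries.order_one] at h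
  exact (neg_eq_of_add_eq_zero_right h.symm).symm

/-- The valuation ring of the field of Hahn series: the series supported in nonnegative degrees. -/
def hahnValuationSubring : ValuationSubring (HahnSeries G F) where
  carrier := {x | 0 ≤ x.orderTop}
  zero_mem' := by simp
  one_mem' := by simp
  mul_mem' {x y} hx hy := by
    simp only [Set.mem_ofPred_eq, HahnSeries.orderTop_mul] at *
    exact add_nonneg hx hy
  add_mem' {x y} hx hy := by
    simp only [Set.mem_ofPred_eq] at *
    exact (le_min hx hy).trans HahnSeries.min_orderTop_le_orderTop_add
  neg_mem' {x} hx := by simpa using hx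
  mem_or_inv_mem' x := by
    rcases eq_or_ne x 0 with rfl | hx
    · simp
    · simp only [Set.mem_ofPred_eq, ← HahnSeries.order_eq_orderTop_of_ne_zero hx,
        ← HahnSeries.order_eq_orderTop_of_ne_zero (inv_ne_zero hx),
        HahnSeries.order_inv_eq_neg hx, WithTop.coe_nonneg, neg_nonneg]
      exact le_total 0 x.order

variable {G F}

theorem mem_hahnValuationSubring {x : HahnSeries G F} (hx : x ≠ 0) :
    x ∈ hahnValuationSubring G F ↔ 0 ≤ x.order := by
  change x ∈ {x : HahnSeries G F | 0 ≤ x.orderTop} ↔ _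
  rw [Set.mem_ofPred_eq, ← HahnSeries.order_eq_orderTop_of_ne_zero hx, WithTop.coe_nonneg]

theorem GroupOfDivisibility.mk_le_mk_iff_order_le {x y : (HahnSeries G F)ˣ} :
    mk (hahnValuationSubring G F) _ x ≤ mk (hahnValuationSubring G F) _ y ↔
      (x : HahnSeries G F).order ≤ (y : HahnSeries G F).order := by
  have h : (∃ d : hahnValuationSubring G F, algebraMap _ (HahnSeries G F) d =
      y * (x : HahnSeries G F)⁻¹) ↔
      (y * (x : HahnSeries G F)⁻¹ : HahnSeries G F) ∈ hahnValuationSubring G F :=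
    ⟨fun ⟨d, hd⟩ => hd ▸ d.2, fun h => ⟨⟨_, h⟩, rfl⟩⟩
  have hx := inv_ne_zero x.ne_zero
  rw [mk_le_mk, h, mem_hahnValuationSubring (mul_ne_zero y.ne_zero hx),
    HahnSeries.order_mul y.ne_zero hx, HahnSeries.order_inv_eq_neg x.ne_zero, ← sub_eq_add_neg,
    sub_nonneg]

/-- Every linearly ordered abelian group is the group of divisibility of a valuation domain. -/
theorem nonempty_orderAddMonoidIso_groupOfDivisibility :
    Nonempty (G ≃+o
      Additive (GroupOfDivisibility (hahnValuationSubring G F) (HahnSeries G F))) := by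
  -- The monomial of degree `g` represents the class of all series of order `g`.
  let s (g : G) : (HahnSeries G F)ˣ :=
    Units.mk0 (HahnSeries.single g 1) (HahnSeries.single_ne_zero one_ne_zero)
  have hs (g : G) : (s g : HahnSeries G F).order = g := HahnSeries.order_single one_ne_zero
  let f (g : G) : Additive (GroupOfDivisibility (hahnValuationSubring G F) (HahnSeries G F)) :=
    Additive.ofMul (GroupOfDivisibility.mk _ _ (s g))
  have hf {g h : G} : f g ≤ f h ↔ g ≤ h :=
    GroupOfDivisibility.mk_le_mk_iff_order_le.trans (by rw [hs, hs])
  have hbij : Function.Bijective f := by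
    refine ⟨fun g h e => le_antisymm (hf.mp e.le) (hf.mp e.ge), fun x => ?_⟩
    obtain ⟨y, hy⟩ := GroupOfDivisibility.mk_surjective x.toMul
    refine ⟨(y : HahnSeries G F).order, ?_⟩
    change GroupOfDivisibility.mk _ _ (s _) = x.toMul
    rw [← hy]
    apply le_antisymm <;> rw [GroupOfDivisibility.mk_le_mk_iff_order_le, hs]
  refine ⟨OrderAddMonoidIso.mk' (Equiv.ofBijective f hbij) hf fun g h => ?_⟩
  have hmul : s (g + h) = s g * s h := by ext1; simp [s]
  change Additive.ofMul (GroupOfDivisibility.mk _ _ (s (g + h))) = _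
  rw [hmul, map_mul]
  rfl

end HahnSeries

theorem corollary2p3 {R : Type u} [DivisionRing R] [Lattice R] [IsOrderedAddMonoid R]
    (hmul : ∀ a b : R, 0 ≤ a → 0 ≤ b → 0 ≤ a * b) :
    List.TFAE [
      ∀ a : R, 0 ≤ a ^ 2,
      IsOrderDivisionClosed R,
      ∀ a b : R, a ≤ b ∨ b ≤ a,
      ∀ a : R, ∃ n : ℕ, 1 ≤ n ∧ 0 ≤ a ^ n,
      IsFRing R,
      IsAlmostFRing R,
      ∃ (D K : Type u) (_ : CommRing D) (_ : IsDomain D) (_ : ValuationRing D)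
        (_ : Field K) (_ : Algebra D K) (_ : IsFractionRing D K),
        Nonempty (R ≃+o Additive (GroupOfDivisibility D K)),
      ∀ a : R, 0 < a → 0 < a⁻¹] := by
  tfae_have 1 → 4 := fun h a => ⟨2, one_le_two, h a⟩
  tfae_have 4 → 8 := inv_pos_of_exists_pow_nonneg hmul
  tfae_have 2 → 8 := IsOrderDivisionClosed.inv_pos
  tfae_have 8 → 3 := total_of_inv_pos hmul
  tfae_have 3 → 1 := sq_nonneg_of_total hmul
  tfae_have 3 → 2 := isOrderDivisionClosed_of_total hmul
  tfae_have 3 → 5 := isFRing_of_total hmul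
  tfae_have 5 → 6 := IsFRing.isAlmostFRing
  tfae_have 6 → 3 := fun h =>
    total_of_disjoint_imp_eq_zero fun a b hab => mul_eq_zero.mp (h a b hab)
  tfae_have 7 → 3 := by
    rintro ⟨D, K, _, _, _, _, _, _, ⟨e⟩⟩ a b
    rw [← map_le_map_iff e, ← map_le_map_iff e]
    exact GroupOfDivisibility.le_total_of_valuationRing (D := D) (K := K)
      (e a).toMul (e b).toMul
  tfae_have 3 → 7 := by
    classical
    intro h
    let : Std.Total (α := R) (· ≤ ·) := ⟨h⟩
    let : LinearOrder R := Lattice.toLinearOrder R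
    -- Only the additive ordered group of `R` enters as exponents; any coefficient field would serve
    -- in place of `ℚ`.
    exact ⟨hahnValuationSubring R ℚ, HahnSeries R ℚ, inferInstance, inferInstance, inferInstance,
      inferInstance, inferInstance, inferInstance, nonempty_orderAddMonoidIso_groupOfDivisibility⟩
  tfae_finish
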